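/- For a finite connected simple graph $G=(V,E)$ whose edges fail independently with probability $q$, the all-terminal reliability polynomial is $$\mathrm{Rel}(G;q)=\sum_{E'}(1-q)^{|E'|}q^{|E|-|E'|},$$ where the sum is over all $E'\subseteq E$ such that the spanning subgraph $(V,E')$ is connected. Let $$\beta=\frac{\left(3\sqrt{708}-\frac{629}{8}\right)^{1/3}}{12}-\frac{23}{48\left(3\sqrt{708}-\frac{629}{8}\right)^{1/3}}-\frac{5}{24}\approx-0.5707202981$$ (with an error of at most $10^{-10}$ in the decimal value). The real roots of the reliability polynomials of finite connected simple graphs are dense in the interval $[\beta,0]$; that is, every point of $[\beta,0]$ is a limit of points of $[\beta,0]$ each of which is a root of $\mathrm{Rel}(G;q)$ for some finite connected simple graph $G$. -/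

import Mathlib

open Polynomial

open Classical in
/-- The (all-terminal) reliability polynomial of a finite simple graph `G`, in the variable
`q` = probability that an edge fails:
the sum of `(1 - q) ^ |E'| * q ^ (|E| - |E'|)` over all sets `E'` of edges of `G` such that the
spanning subgraph with edge set `E'` (on all the vertices of `G`) is connected. -/
noncomputable def reliabilityPolynomial {V : Type*} [Fintype V] (G : SimpleGraph V) : ℝ[X] :=
  ∑ E' ∈ G.edgeFinset.powerset.filter (fun E' : Finset (Sym2 V) =>
      (SimpleGraph.fromEdgeSet (E' : Set (Sym2 V))).Connected),
    (1 - X) ^ E'.card * X ^ (G.edgeFinset.card - E'.card)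

/-- The set of real reliability roots of (finite, connected, simple) graphs. Connectedness is
part of the definition: the reliability polynomial of a disconnected graph is zero. -/
def realReliabilityRoots : Set ℝ :=
  {q | ∃ (V : Type) (_ : Fintype V) (G : SimpleGraph V),
    G.Connected ∧ (reliabilityPolynomial G).IsRoot q}

/-- The constant `β`; the radicand `3 √708 - 629 / 8` of the cube roots is positive. -/
noncomputable def reliabilityBeta : ℝ :=
  (3 * Real.sqrt 708 - 629 / 8) ^ (1 / 3 : ℝ) / 12
    - 23 / (48 * (3 * Real.sqrt 708 - 629 / 8) ^ (1 / 3 : ℝ)) - 5 / 24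

/-- The edges `e` with `x e = true` connect all the vertices, where the edge `e` joins `src e`
to `tgt e`: every two-colouring that is constant along these edges is constant. -/
def EdgesConnect {V ι : Type*} (src tgt : ι → V) (x : ι → Bool) : Prop :=
  ∀ c : V → Bool, (∀ e, x e = true → c (src e) = c (tgt e)) → ∀ v w, c v = c w

theorem SimpleGraph.connected_iff_forall_coloring_const {V : Type*} [Nonempty V]
    (G : SimpleGraph V) :
    G.Connected ↔ ∀ c : V → Bool, (∀ v w, G.Adj v w → c v = c w) → ∀ v w, c v = c w := by
  classical
  constructor
  · intro h c hc v w
    obtain ⟨p⟩ := h.preconnected v w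
    induction p with
    | nil => rfl
    | cons hadj _ ih => exact (hc _ _ hadj).trans ih
  · intro h
    refine ⟨fun v w => ?_⟩
    have := h (fun u => decide (G.Reachable v u)) (fun a b hab => by
      simp only [decide_eq_decide]
      exact ⟨fun h => h.trans hab.reachable, fun h => h.trans hab.symm.reachable⟩) v w
    simpa using this

theorem eval_reliabilityPolynomial_fromEdgeSet {V ι : Type*} [Fintype V] [Nonempty V]
    [Fintype ι] [DecidableEq ι] (src tgt : ι → V)
    (hinj : Function.Injective fun e => s(src e, tgt e))
    (hne : ∀ e, src e ≠ tgt e) (q : ℝ) [DecidablePred (EdgesConnect src tgt)] :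
    (reliabilityPolynomial
        (SimpleGraph.fromEdgeSet (Set.range fun e => s(src e, tgt e)))).eval q =
      ∑ x : ι → Bool, if EdgesConnect src tgt x then
        ∏ e, (if x e = true then 1 - q else q) else 0 := by
  classical
  set φ : ι ↪ Sym2 V := ⟨fun e => s(src e, tgt e), hinj⟩ with hφ
  have hE : ∀ inst : Fintype
      (SimpleGraph.fromEdgeSet (Set.range fun e => s(src e, tgt e))).edgeSet,
      @SimpleGraph.edgeFinset _ _ inst = Finset.univ.map φ := by
    intro inst
    ext e
    simp only [SimpleGraph.mem_edgeFinset, SimpleGraph.edgeSet_fromEdgeSet, Set.mem_sdiff,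
      Set.mem_range, Finset.mem_map, Finset.mem_univ, true_and]
    constructor
    · rintro ⟨⟨i, rfl⟩, -⟩
      exact ⟨i, rfl⟩
    · rintro ⟨i, rfl⟩
      exact ⟨⟨i, rfl⟩, by simpa [hφ] using hne i⟩
  unfold reliabilityPolynomial
  simp only [hE]
  rw [Finset.sum_filter, Polynomial.eval_finsetSum]
  symm
  refine Finset.sum_nbij (fun x => (Finset.univ.filter fun e => x e = true).map φ) ?_ ?_ ?_ ?_
  · intro x _
    rw [Finset.mem_powerset]
    exact Finset.map_subset_map.2 (Finset.subset_univ _)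
  · intro x _ y _ hxy
    have := Finset.map_injective φ hxy
    funext e
    have h := congrArg (fun s => e ∈ s) this
    simp only [Finset.mem_filter, Finset.mem_univ, true_and, eq_iff_iff] at h
    exact Bool.eq_iff_iff.2 h
  · intro E' hE'
    rw [Finset.mem_coe, Finset.mem_powerset] at hE'
    refine ⟨fun e => decide (φ e ∈ E'), by simp, ?_⟩
    ext e
    simp only [decide_eq_true_eq, Finset.mem_map, Finset.mem_filter, Finset.mem_univ, true_and]
    constructor
    · rintro ⟨i, hi, rfl⟩
      exact hi
    · intro he
      obtain ⟨i, -, rfl⟩ := Finset.mem_map.1 (hE' he)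
      exact ⟨i, he, rfl⟩
  · intro x _
    have hconn : (SimpleGraph.fromEdgeSet
        (((Finset.univ.filter fun e => x e = true).map φ : Finset (Sym2 V)) :
          Set (Sym2 V))).Connected ↔ EdgesConnect src tgt x := by
      rw [SimpleGraph.connected_iff_forall_coloring_const]
      refine forall_congr' fun c => imp_congr_left ?_
      simp only [SimpleGraph.fromEdgeSet_adj, Finset.coe_map, Set.mem_image, Finset.mem_coe,
        Finset.mem_filter, Finset.mem_univ, true_and]
      constructor
      · intro h e he
        exact h _ _ ⟨⟨e, he, rfl⟩, hne e⟩
      · rintro h v w ⟨⟨e, he, hvw⟩, -⟩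
        have hvw : s(src e, tgt e) = s(v, w) := hvw
        rcases Sym2.eq_iff.1 hvw with ⟨rfl, rfl⟩ | ⟨rfl, rfl⟩
        · exact h e he
        · exact (h e he).symm
    by_cases hx : EdgesConnect src tgt x
    · rw [if_pos hx, if_pos (hconn.2 hx), Finset.prod_ite, Finset.prod_const, Finset.prod_const]
      have hsplit := Finset.card_filter_add_card_filter_not (s := (Finset.univ : Finset ι))
        (fun e => x e = true)
      rw [Finset.card_univ] at hsplit
      rw [Polynomial.eval_mul, Polynomial.eval_pow, Polynomial.eval_pow, Finset.card_map,
        Finset.card_map, Finset.card_univ, ← hsplit, Nat.add_sub_cancel_left]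
      simp
    · rw [if_neg hx, if_neg (mt hconn.1 hx), Polynomial.eval_zero]

section CycleOfGadgets

variable {J ε : Type*}

/-- The edges of a gadget chosen by `x` connect every inner vertex to a terminal: the gadget
becomes connected once the two terminals `Sum.inl false` and `Sum.inl true` are identified. -/
def AttachesToTerminals (src : ε → J) (tgt : ε → Bool ⊕ J) (x : ε → Bool) : Prop :=
  ∀ c : Bool ⊕ J → Bool, (∀ e, x e = true → c (.inr (src e)) = c (tgt e)) →
    c (.inl false) = c (.inl true) → ∀ v w, c v = c w

/-- The embedding of the `(i, l)`-th gadget into the vertex set of the cycle of gadgets. -/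
def gadgetVertex {m k : ℕ} (i : Fin (m + 2)) (l : Fin k) :
    Bool ⊕ J → Fin (m + 2) ⊕ (Fin (m + 2) × Fin k × J) :=
  Sum.elim (fun b => .inl (bif b then i + 1 else i)) (fun j => .inr (i, l, j))

theorem gadgetVertex_injective {m k : ℕ} (i : Fin (m + 2)) (l : Fin k) :
    Function.Injective (gadgetVertex (J := J) i l) := by
  have hi : i + 1 ≠ i := by simp
  rintro ((_ | _) | _) ((_ | _) | _) h <;> simp_all [gadgetVertex]

/-- One end of an edge of the cycle of gadgets: an inner vertex. -/
def cycleSrc {m k : ℕ} (src : ε → J) (e : Fin (m + 2) × Fin k × ε) :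
    Fin (m + 2) ⊕ (Fin (m + 2) × Fin k × J) :=
  gadgetVertex e.1 e.2.1 (.inr (src e.2.2))

/-- The other end of an edge of the cycle of gadgets. -/
def cycleTgt {m k : ℕ} (tgt : ε → Bool ⊕ J) (e : Fin (m + 2) × Fin k × ε) :
    Fin (m + 2) ⊕ (Fin (m + 2) × Fin k × J) :=
  gadgetVertex e.1 e.2.1 (tgt e.2.2)

theorem eq_of_gadgetVertex_eq_inr {m k : ℕ} {i i' : Fin (m + 2)} {l l' : Fin k} {v : Bool ⊕ J}
    {j : J} (h : gadgetVertex i l v = .inr (i', l', j)) : i = i' ∧ l = l' := by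
  rcases v with _ | _ <;> simp_all [gadgetVertex]

theorem cycleEdge_injective {m k : ℕ} {src : ε → J} {tgt : ε → Bool ⊕ J}
    (hinj : Function.Injective fun e => s(.inr (src e), tgt e)) :
    Function.Injective fun e : Fin (m + 2) × Fin k × ε =>
      s(cycleSrc src e, cycleTgt tgt e) := by
  rintro ⟨i, l, e⟩ ⟨i', l', e'⟩ h
  have hil : i' = i ∧ l' = l := by
    rcases Sym2.eq_iff.1 h with ⟨h1, -⟩ | ⟨h1, -⟩
    · exact eq_of_gadgetVertex_eq_inr h1.symm
    · exact eq_of_gadgetVertex_eq_inr h1.symm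
  obtain ⟨rfl, rfl⟩ := hil
  have h' : Sym2.map (gadgetVertex i' l') s(.inr (src e), tgt e) =
      Sym2.map (gadgetVertex i' l') s(.inr (src e'), tgt e') := h
  rw [hinj (Sym2.map.injective (gadgetVertex_injective i' l') h')]

open Fin.CommRing in
theorem cycle_coloring_const {m : ℕ} (c : Fin (m + 2) → Bool) (i₀ : Fin (m + 2))
    (h : ∀ i, i ≠ i₀ → c i = c (i + 1)) (i j : Fin (m + 2)) : c i = c j := by
  have key : ∀ d : ℕ, d < m + 2 → c (i₀ + 1 + (d : Fin (m + 2))) = c (i₀ + 1) := by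
    intro d
    induction d with
    | zero => simp
    | succ d ih =>
      intro hd
      rw [Nat.cast_succ, ← add_assoc, ← h _ ?_, ih (by omega)]
      intro h0
      have h1 : ((d + 1 : ℕ) : Fin (m + 2)) = 0 := by
        have : i₀ + ((d : Fin (m + 2)) + 1) = i₀ + 0 :=
          calc i₀ + ((d : Fin (m + 2)) + 1) = i₀ + 1 + d := by ring
            _ = i₀ + 0 := by rw [h0, add_zero]
        simpa using add_left_cancel this
      rw [Fin.natCast_eq_zero] at h1
      exact absurd (Nat.le_of_dvd (by omega) h1) (by omega)
  have all : ∀ j, c j = c (i₀ + 1) := by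
    intro j
    have := key (j - (i₀ + 1)).val (j - (i₀ + 1)).isLt
    rwa [Fin.cast_val_eq_self, add_sub_cancel] at this
  rw [all i, all j]

theorem exists_cycle_coloring {m : ℕ} {i j : Fin (m + 2)} (hij : i ≠ j) :
    ∃ c : Fin (m + 2) → Bool, (∃ v w, c v ≠ c w) ∧
      ∀ l, l ≠ i → l ≠ j → c l = c (l + 1) := by
  wlog hlt : i < j generalizing i j
  · obtain ⟨c, hc, h⟩ := this hij.symm (lt_of_le_of_ne (not_lt.1 hlt) hij.symm)
    exact ⟨c, hc, fun l hi hj => h l hj hi⟩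
  refine ⟨fun v => decide (i < v ∧ v ≤ j), ⟨i, j, by simp [hlt]⟩, fun l hi hj => ?_⟩
  rw [decide_eq_decide]
  simp only [Fin.lt_def, Fin.le_def, Fin.ext_iff, Fin.val_add_one, ne_eq, Fin.val_last] at *
  split_ifs <;> omega

theorem edgesConnect_cycle_iff {m k : ℕ} (src : ε → J) (tgt : ε → Bool ⊕ J)
    (x : Fin (m + 2) → Fin k → ε → Bool) :
    EdgesConnect (cycleSrc src) (cycleTgt tgt) (fun e => x e.1 e.2.1 e.2.2) ↔
      (∀ i l, AttachesToTerminals src tgt (x i l)) ∧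
      ∀ i j, (∀ l, ¬ EdgesConnect (fun e => .inr (src e)) tgt (x i l)) →
        (∀ l, ¬ EdgesConnect (fun e => .inr (src e)) tgt (x j l)) → i = j := by
  classical
  constructor
  · intro h
    have hatt : ∀ i l, AttachesToTerminals src tgt (x i l) := by
      intro i l c hc hst v w
      have key := h (Sum.elim (fun _ => c (.inl false))
        (fun p => if p.1 = i ∧ p.2.1 = l then c (.inr p.2.2) else c (.inl false))) (by
          rintro ⟨i', l', e⟩ he
          by_cases hil : i' = i ∧ l' = l
          · obtain ⟨rfl, rfl⟩ := hil
            have := hc e he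
            rcases ht : tgt e with b | j
            · rw [ht] at this
              cases b <;> simp [cycleSrc, cycleTgt, gadgetVertex, ht, this, hst]
            · rw [ht] at this
              simp [cycleSrc, cycleTgt, gadgetVertex, ht, this]
          · rcases ht : tgt e with b | j <;>
              simp [cycleSrc, cycleTgt, gadgetVertex, ht, hil])
      have all : ∀ v, c v = c (.inl false) := by
        rintro ((_ | _) | j)
        · rfl
        · exact hst.symm
        · simpa using key (.inr (i, l, j)) (.inl i)
      rw [all v, all w]
    refine ⟨hatt, fun i j hi hj => ?_⟩
    by_contra hij
    obtain ⟨c, ⟨v, w, hvw⟩, hc⟩ := exists_cycle_coloring hij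
    have hext : ∀ i' l', ∃ d : Bool ⊕ J → Bool,
        (∀ e, x i' l' e = true → d (.inr (src e)) = d (tgt e)) ∧
          d (.inl false) = c i' ∧ d (.inl true) = c (i' + 1) := by
      intro i' l'
      by_cases hcc : c i' = c (i' + 1)
      · exact ⟨fun _ => c i', fun _ _ => rfl, rfl, hcc⟩
      · have hn : ¬ EdgesConnect (fun e => .inr (src e)) tgt (x i' l') := by
          by_cases h1 : i' = i
          · exact h1 ▸ hi l'
          · by_cases h2 : i' = j
            · exact h2 ▸ hj l'
            · exact absurd (hc i' h1 h2) hcc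
        unfold EdgesConnect at hn
        push Not at hn
        obtain ⟨d, hd, v, w, hd'⟩ := hn
        have hne : d (.inl false) ≠ d (.inl true) := fun h => hd' (hatt i' l' d hd h v w)
        refine ⟨fun u => (d u ^^ (d (.inl false) ^^ c i')), fun e he => ?_, ?_, ?_⟩
        · show (d _ ^^ _) = (d _ ^^ _)
          rw [hd e he]
        · show (d _ ^^ _) = _
          cases d (.inl false) <;> simp
        · show (d _ ^^ _) = _
          revert hne hcc
          generalize d (.inl false) = a
          generalize d (.inl true) = b
          generalize c i' = a'
          generalize c (i' + 1) = b'
          revert a b a' b'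
          decide
    choose d hd hd0 hd1 using hext
    refine hvw (h (Sum.elim c fun p => d p.1 p.2.1 (.inr p.2.2)) ?_ (.inl v) (.inl w))
    rintro ⟨i', l', e⟩ he
    have := hd i' l' e he
    rcases ht : tgt e with b | j
    · rw [ht] at this
      cases b <;> simp [cycleSrc, cycleTgt, gadgetVertex, ht, this, hd0, hd1]
    · rw [ht] at this
      simp [cycleSrc, cycleTgt, gadgetVertex, ht, this]
  · rintro ⟨hatt, huniq⟩ c hc
    have hgad : ∀ i l e, x i l e = true →
        (c ∘ gadgetVertex i l) (.inr (src e)) = (c ∘ gadgetVertex i l) (tgt e) :=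
      fun i l e he => hc (i, l, e) he
    have hstep : ∀ i, ¬ (∀ l, ¬ EdgesConnect (fun e => .inr (src e)) tgt (x i l)) →
        c (.inl i) = c (.inl (i + 1)) := by
      intro i hi
      push Not at hi
      obtain ⟨l, hl⟩ := hi
      exact hl (c ∘ gadgetVertex i l) (hgad i l) (.inl false) (.inl true)
    have hcyc : ∀ i j, c (.inl i) = c (.inl j) := by
      by_cases hex : ∃ i₀, ∀ l, ¬ EdgesConnect (fun e => .inr (src e)) tgt (x i₀ l)
      · obtain ⟨i₀, h0⟩ := hex
        exact cycle_coloring_const (fun i => c (.inl i)) i₀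
          (fun i hi => hstep i fun h => hi (huniq i i₀ h h0))
      · push Not at hex
        refine cycle_coloring_const (fun i => c (.inl i)) 0 (fun i _ => hstep i ?_)
        push Not
        exact hex i
    have all : ∀ v, c v = c (.inl 0) := by
      rintro (i | ⟨i, l, j⟩)
      · exact hcyc _ _
      · have := hatt i l (c ∘ gadgetVertex i l) (hgad i l) (hcyc _ _) (.inr j) (.inl false)
        exact this.trans (hcyc _ _)
    intro v w
    rw [all v, all w]

end CycleOfGadgets

section WeightedSums

open Classical in
theorem sum_pi_ite_forall {K X : Type*} [Fintype K] [DecidableEq K] [Fintype X]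
    (p : X → Prop) (w : X → ℝ) {t : ℝ} (ht : (∑ x, if p x then w x else 0) = t) :
    (∑ y : K → X, if ∀ l, p (y l) then ∏ l, w (y l) else 0) = t ^ Fintype.card K := by
  rw [← ht, ← Finset.card_univ, ← Finset.prod_const, Finset.prod_univ_sum, Fintype.piFinset_univ]
  refine Finset.sum_congr rfl fun y _ => ?_
  split_ifs with h
  · exact Finset.prod_congr rfl fun l _ => (if_pos (h l)).symm
  · push Not at h
    obtain ⟨l, hl⟩ := h
    exact (Finset.prod_eq_zero (Finset.mem_univ l) (if_neg hl)).symm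

open Classical in
theorem sum_pi_ite_forall_and_unique {N Y : Type*} [Fintype N] [DecidableEq N] [Fintype Y]
    (p d : Y → Prop) (w : Y → ℝ) {a b : ℝ}
    (ha : (∑ x, if p x ∧ ¬ d x then w x else 0) = a)
    (hb : (∑ x, if p x ∧ d x then w x else 0) = b) :
    (∑ y : N → Y, if (∀ i, p (y i)) ∧ ∀ i j, d (y i) → d (y j) → i = j
        then ∏ i, w (y i) else 0) =
      a ^ Fintype.card N + Fintype.card N * (b * a ^ (Fintype.card N - 1)) := by
  rw [← ha, ← hb]
  set f : Y → ℝ := fun x => if p x ∧ ¬ d x then w x else 0 with hf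
  set g : Y → ℝ := fun x => if p x ∧ d x then w x else 0 with hg
  have key : ∀ y : N → Y, (if (∀ i, p (y i)) ∧ ∀ i j, d (y i) → d (y j) → i = j
      then ∏ i, w (y i) else 0) =
      ∏ i, f (y i) + ∑ j, ∏ i, (if i = j then g (y i) else f (y i)) := by
    intro y
    by_cases hp : ∀ i, p (y i)
    · by_cases hd : ∃ j, d (y j)
      · obtain ⟨j, hj⟩ := hd
        rw [Finset.prod_eq_zero (f := fun i => f (y i)) (Finset.mem_univ j)
          (by simp [hf, hj]), zero_add,
          Finset.sum_eq_single j]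
        · by_cases hu : ∀ i j, d (y i) → d (y j) → i = j
          · rw [if_pos ⟨hp, hu⟩]
            refine Finset.prod_congr rfl fun i _ => ?_
            split_ifs with hij
            · simp [hg, hij, hp, hj]
            · have : ¬ d (y i) := fun h => hij (hu i j h hj)
              simp [hf, hp, this]
          · rw [if_neg (fun h => hu h.2)]
            push Not at hu
            obtain ⟨a, b, ha, hb, hab⟩ := hu
            obtain ⟨i, hi, hij⟩ : ∃ i, d (y i) ∧ i ≠ j := by
              by_cases haj : a = j
              · exact ⟨b, hb, fun h => hab (haj.trans h.symm)⟩
              · exact ⟨a, ha, haj⟩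
            exact (Finset.prod_eq_zero (Finset.mem_univ i) (by simp [hij, hf, hi])).symm
        · intro i _ hij
          exact Finset.prod_eq_zero (Finset.mem_univ j) (by simp [Ne.symm hij, hf, hj])
        · simp
      · push Not at hd
        rw [if_pos ⟨hp, fun i _ hi => absurd hi (hd i)⟩, Finset.sum_eq_zero, add_zero]
        · exact Finset.prod_congr rfl fun i _ => by simp [hf, hp, hd]
        · intro j _
          exact Finset.prod_eq_zero (Finset.mem_univ j) (by simp [hg, hd])
    · rw [if_neg (fun h => hp h.1)]
      push Not at hp
      obtain ⟨i, hi⟩ := hp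
      rw [Finset.prod_eq_zero (f := fun i => f (y i)) (Finset.mem_univ i) (by simp [hf, hi]),
        Finset.sum_eq_zero,
        add_zero]
      intro j _
      exact Finset.prod_eq_zero (Finset.mem_univ i) (by simp [hf, hg, hi])
  rw [Finset.sum_congr rfl fun y _ => key y, Finset.sum_add_distrib, Finset.sum_comm]
  congr 1
  · rw [← Finset.card_univ, ← Finset.prod_const, Finset.prod_univ_sum, Fintype.piFinset_univ]
  · have hj : ∀ j : N, (∑ y : N → Y, ∏ i, (if i = j then g (y i) else f (y i))) =
        (∑ x, g x) * (∑ x, f x) ^ (Fintype.card N - 1) := by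
      intro j
      have h := Finset.prod_univ_sum (fun _ : N => (Finset.univ : Finset Y))
        (fun i x => if i = j then g x else f x)
      rw [Fintype.piFinset_univ] at h
      rw [← h, ← Finset.mul_prod_erase _ _ (Finset.mem_univ j)]
      congr 1
      · simp
      · rw [Finset.prod_congr rfl (g := fun _ => ∑ x, f x), Finset.prod_const,
          Finset.card_erase_of_mem (Finset.mem_univ j), Finset.card_univ]
        intro i hi
        simp [Finset.ne_of_mem_erase hi]
    rw [Finset.sum_congr rfl fun j _ => hj j, Finset.sum_const, Finset.card_univ, nsmul_eq_mul]

end WeightedSums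

open Classical in
theorem eval_reliabilityPolynomial_cycle {J ε : Type*} [Fintype J] [Fintype ε] [DecidableEq ε]
    {src : ε → J} {tgt : ε → Bool ⊕ J}
    (hinj : Function.Injective fun e => s(.inr (src e), tgt e))
    (hne : ∀ e, .inr (src e) ≠ tgt e) (m k : ℕ) (q T S : ℝ)
    (hT : (∑ x : ε → Bool, if AttachesToTerminals src tgt x then
      ∏ e, (if x e = true then 1 - q else q) else 0) = T)
    (hS : (∑ x : ε → Bool, if AttachesToTerminals src tgt x ∧
        ¬ EdgesConnect (fun e => .inr (src e)) tgt x then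
      ∏ e, (if x e = true then 1 - q else q) else 0) = S) :
    (reliabilityPolynomial (SimpleGraph.fromEdgeSet (Set.range
      fun e : Fin (m + 2) × Fin k × ε => s(cycleSrc src e, cycleTgt tgt e)))).eval q =
      (T ^ k - S ^ k) ^ (m + 1) * (T ^ k + (m + 1) * S ^ k) := by
  have hne' : ∀ e : Fin (m + 2) × Fin k × ε, cycleSrc src e ≠ cycleTgt tgt e :=
    fun e h => hne e.2.2 (gadgetVertex_injective _ _ h)
  rw [eval_reliabilityPolynomial_fromEdgeSet _ _ (cycleEdge_injective hinj) hne']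
  let curry : (Fin (m + 2) × Fin k × ε → Bool) ≃ (Fin (m + 2) → Fin k → ε → Bool) :=
    { toFun := fun x i l e => x (i, l, e)
      invFun := fun x e => x e.1 e.2.1 e.2.2
      left_inv := fun _ => rfl
      right_inv := fun _ => rfl }
  rw [← curry.symm.sum_comp]
  have hterm : ∀ x : Fin (m + 2) → Fin k → ε → Bool,
      (if EdgesConnect (cycleSrc src) (cycleTgt tgt) (curry.symm x) then
        ∏ e, (if curry.symm x e = true then 1 - q else q) else 0) =
      if (∀ i, ∀ l, AttachesToTerminals src tgt (x i l)) ∧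
        (∀ i j, (∀ l, ¬ EdgesConnect (fun e => .inr (src e)) tgt (x i l)) →
          (∀ l, ¬ EdgesConnect (fun e => .inr (src e)) tgt (x j l)) → i = j)
      then ∏ i, ∏ l, ∏ e, (if x i l e = true then 1 - q else q) else 0 := by
    intro x
    refine if_congr (edgesConnect_cycle_iff src tgt x) ?_ rfl
    rw [Fintype.prod_prod_type]
    exact Finset.prod_congr rfl fun i _ => Fintype.prod_prod_type _
  rw [Finset.sum_congr rfl fun x _ => hterm x]
  have hcongr : ∀ {X : Type _} [Fintype X] (p : X → Prop) (w : X → ℝ)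
      {d d' : DecidablePred p} {t : ℝ}, (∑ x, @ite _ (p x) (d x) (w x) 0) = t →
        (∑ x, @ite _ (p x) (d' x) (w x) 0) = t := by
    intro X _ p w d d' t h
    rwa [Subsingleton.elim d' d]
  have hb : (∑ y : Fin k → ε → Bool, if (∀ l, AttachesToTerminals src tgt (y l)) ∧
      (∀ l, ¬ EdgesConnect (fun e => .inr (src e)) tgt (y l)) then
      ∏ l, ∏ e, (if y l e = true then 1 - q else q) else 0) = S ^ k := by
    refine (Finset.sum_congr rfl fun _ _ => if_congr forall_and.symm rfl rfl).trans
      ((hcongr _ _ (sum_pi_ite_forall (K := Fin k) (X := ε → Bool)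
        (fun x => AttachesToTerminals src tgt x ∧
          ¬ EdgesConnect (fun e => .inr (src e)) tgt x)
        (fun x => ∏ e, (if x e = true then 1 - q else q)) (hcongr _ _ hS))).trans ?_)
    rw [Fintype.card_fin]
  have ha : (∑ y : Fin k → ε → Bool, if (∀ l, AttachesToTerminals src tgt (y l)) ∧
      ¬ (∀ l, ¬ EdgesConnect (fun e => .inr (src e)) tgt (y l)) then
      ∏ l, ∏ e, (if y l e = true then 1 - q else q) else 0) = T ^ k - S ^ k := by
    have hT' := sum_pi_ite_forall (K := Fin k) (X := ε → Bool)
      (fun x => AttachesToTerminals src tgt x)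
      (fun x => ∏ e, (if x e = true then 1 - q else q)) hT
    rw [Fintype.card_fin] at hT'
    rw [← hT', ← hb, ← Finset.sum_sub_distrib]
    refine Finset.sum_congr rfl fun y _ => ?_
    by_cases h1 : ∀ l, AttachesToTerminals src tgt (y l) <;>
      by_cases h2 : ∀ l, ¬ EdgesConnect (fun e => .inr (src e)) tgt (y l) <;>
      simp [h1, h2]
  refine (hcongr _ _ (sum_pi_ite_forall_and_unique (N := Fin (m + 2)) (Y := Fin k → ε → Bool)
    (fun y => ∀ l, AttachesToTerminals src tgt (y l))
    (fun y => ∀ l, ¬ EdgesConnect (fun e => .inr (src e)) tgt (y l))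
    (fun y => ∏ l, ∏ e, (if y l e = true then 1 - q else q)) (hcongr _ _ ha)
    (hcongr _ _ hb))).trans ?_
  rw [Fintype.card_fin]
  rw [show m + 2 - 1 = m + 1 from rfl]
  push_cast
  ring

theorem fromEdgeSet_connected_of_edgesConnect {V ι : Type*} [Nonempty V] (src tgt : ι → V)
    (hne : ∀ e, src e ≠ tgt e) (h : EdgesConnect src tgt fun _ => true) :
    (SimpleGraph.fromEdgeSet (Set.range fun e => s(src e, tgt e))).Connected := by
  rw [SimpleGraph.connected_iff_forall_coloring_const]
  intro c hc
  exact h c fun e _ => hc _ _ ((SimpleGraph.fromEdgeSet_adj _).2 ⟨⟨e, rfl⟩, hne e⟩)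

open Classical in
theorem mem_realReliabilityRoots_of_gadget {J ε : Type} [Fintype J] [Fintype ε] [DecidableEq ε]
    {src : ε → J} {tgt : ε → Bool ⊕ J}
    (hinj : Function.Injective fun e => s(.inr (src e), tgt e))
    (hne : ∀ e, .inr (src e) ≠ tgt e)
    (hconn : EdgesConnect (fun e => .inr (src e)) tgt fun _ => true)
    {m k : ℕ} (hk : k ≠ 0) {q T S : ℝ}
    (hT : (∑ x : ε → Bool, if AttachesToTerminals src tgt x then
      ∏ e, (if x e = true then 1 - q else q) else 0) = T)
    (hS : (∑ x : ε → Bool, if AttachesToTerminals src tgt x ∧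
        ¬ EdgesConnect (fun e => .inr (src e)) tgt x then
      ∏ e, (if x e = true then 1 - q else q) else 0) = S)
    (h : T ^ k + (m + 1) * S ^ k = 0) : q ∈ realReliabilityRoots := by
  have : NeZero k := ⟨hk⟩
  refine ⟨_, inferInstance, SimpleGraph.fromEdgeSet (Set.range
    fun e : Fin (m + 2) × Fin k × ε => s(cycleSrc src e, cycleTgt tgt e)), ?_, ?_⟩
  · refine fromEdgeSet_connected_of_edgesConnect _ _
      (fun e h => hne e.2.2 (gadgetVertex_injective _ _ h)) ?_
    refine (edgesConnect_cycle_iff src tgt fun _ _ _ => true).2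
      ⟨fun i l c hc _ => hconn c hc, fun i j hi _ => absurd hconn (hi 0)⟩
  · rw [Polynomial.IsRoot, eval_reliabilityPolynomial_cycle hinj hne m k q T S hT hS, h, mul_zero]

section Path

/-- The inner ends of the edges of the path of length two between the terminals. -/
def pathSrc : Bool → Unit := fun _ => ()

/-- The terminal ends of the edges of the path of length two between the terminals. -/
def pathTgt : Bool → Bool ⊕ Unit := .inl

theorem attachesToTerminals_path_iff (x : Bool → Bool) :
    AttachesToTerminals pathSrc pathTgt x ↔ (x false || x true) = true := by
  unfold AttachesToTerminals pathSrc pathTgt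
  revert x
  decide

theorem edgesConnect_path_iff (x : Bool → Bool) :
    EdgesConnect (fun e => .inr (pathSrc e)) pathTgt x ↔ (x false && x true) = true := by
  unfold EdgesConnect pathSrc pathTgt
  revert x
  decide

theorem mem_realReliabilityRoots_of_path {m k : ℕ} (hk : k ≠ 0) {q : ℝ}
    (h : (1 - q ^ 2) ^ k + (m + 1) * (2 * q * (1 - q)) ^ k = 0) :
    q ∈ realReliabilityRoots := by
  refine mem_realReliabilityRoots_of_gadget (src := pathSrc) (tgt := pathTgt) (m := m)
    (T := 1 - q ^ 2) (S := 2 * q * (1 - q)) ?_ ?_ ?_ hk ?_ ?_ h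
  · decide
  · decide
  · rw [edgesConnect_path_iff]; rfl
  · rw [← (Equiv.boolArrowEquivProd Bool).symm.sum_comp]
    simp [attachesToTerminals_path_iff, Fintype.sum_prod_type]
    ring
  · rw [← (Equiv.boolArrowEquivProd Bool).symm.sum_comp]
    simp [attachesToTerminals_path_iff, edgesConnect_path_iff, Fintype.sum_prod_type]
    ring

end Path

section Diamond

/-- The first ends of the edges of the diamond `K₄ - e` with non-adjacent terminals. -/
def diamondSrc : Fin 5 → Bool := ![false, false, true, true, false]

/-- The second ends of the edges of the diamond `K₄ - e` with non-adjacent terminals. -/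
def diamondTgt : Fin 5 → Bool ⊕ Bool :=
  ![.inl false, .inl true, .inl false, .inl true, .inr true]

theorem attachesToTerminals_diamond_iff (x : Fin 5 → Bool) :
    AttachesToTerminals diamondSrc diamondTgt x ↔
      ((x 0 || x 1 || x 4) && (x 2 || x 3 || x 4) && (x 0 || x 1 || x 2 || x 3)) = true := by
  unfold AttachesToTerminals diamondSrc diamondTgt
  revert x
  set_option maxRecDepth 100000 in
  decide

theorem edgesConnect_diamond_iff (x : Fin 5 → Bool) :
    EdgesConnect (fun e => .inr (diamondSrc e)) diamondTgt x ↔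
      ((x 0 || x 1 || x 4) && (x 2 || x 3 || x 4) && (x 0 || x 1 || x 2 || x 3) &&
        (x 0 || x 2) && (x 1 || x 3) && (x 1 || x 2 || x 4) && (x 0 || x 3 || x 4)) = true := by
  unfold EdgesConnect diamondSrc diamondTgt
  revert x
  set_option maxRecDepth 100000 in
  decide

theorem sum_fin_five_arrow_bool (f : (Fin 5 → Bool) → ℝ) :
    ∑ x, f x = ∑ a, ∑ b, ∑ c, ∑ d, ∑ e, f ![a, b, c, d, e] := by
  let φ : Bool × Bool × Bool × Bool × Bool ≃ (Fin 5 → Bool) :=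
    { toFun := fun p => ![p.1, p.2.1, p.2.2.1, p.2.2.2.1, p.2.2.2.2]
      invFun := fun x => (x 0, x 1, x 2, x 3, x 4)
      left_inv := fun _ => rfl
      right_inv := fun x => by
        funext i
        fin_cases i <;> rfl }
  rw [← φ.sum_comp]
  simp only [Fintype.sum_prod_type]
  rfl

theorem mem_realReliabilityRoots_of_diamond {m k : ℕ} (hk : k ≠ 0) {q : ℝ}
    (h : ((1 - q) ^ 2 * ((1 + q) * (1 + q + 2 * q ^ 2))) ^ k +
      (m + 1) * ((1 - q) ^ 2 * (2 * q ^ 2 * (1 + 3 * q))) ^ k = 0) :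
    q ∈ realReliabilityRoots := by
  refine mem_realReliabilityRoots_of_gadget (src := diamondSrc) (tgt := diamondTgt) (m := m)
    ?_ ?_ ?_ hk ?_ ?_ h
  · decide
  · decide
  · rw [edgesConnect_diamond_iff]; rfl
  · rw [sum_fin_five_arrow_bool]
    simp [attachesToTerminals_diamond_iff, Fin.prod_univ_five]
    ring
  · rw [sum_fin_five_arrow_bool]
    simp [attachesToTerminals_diamond_iff, edgesConnect_diamond_iff, Fin.prod_univ_five]
    ring

end Diamond

theorem exists_nat_mem_Icc_pow_inv {y z : ℝ} (hy : 0 < y) (hyz : y < z) (hz : z < 1) :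
    ∃ k m : ℕ, Odd k ∧ 1 / ((m : ℝ) + 1) ∈ Set.Icc (y ^ k) (z ^ k) := by
  have hz0 : 0 < z := hy.trans hyz
  have hr : 1 < z / y := (one_lt_div hy).2 hyz
  obtain ⟨n, hn⟩ := pow_unbounded_of_one_lt 2 hr
  set k := 2 * n + 1 with hk
  have hk2 : 2 < (z / y) ^ k := hn.trans_le (pow_le_pow_right₀ hr.le (by omega))
  have hzk : 0 < z ^ k := pow_pos hz0 k
  have hyk : 0 < y ^ k := pow_pos hy k
  have hzk1 : z ^ k < 1 := pow_lt_one₀ hz0.le hz (by omega)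
  rw [div_pow, lt_div_iff₀ hyk] at hk2
  refine ⟨k, ⌊1 / z ^ k⌋₊, ⟨n, hk⟩, ?_, ?_⟩
  · have h1 : (⌊1 / z ^ k⌋₊ : ℝ) ≤ 1 / z ^ k := Nat.floor_le (by positivity)
    have h2 : 1 ≤ 1 / z ^ k := (one_le_div hzk).2 hzk1.le
    rw [le_div_iff₀ (by positivity)]
    calc y ^ k * (⌊1 / z ^ k⌋₊ + 1) ≤ y ^ k * (2 * (1 / z ^ k)) := by gcongr; linarith
      _ = 2 * y ^ k / z ^ k := by ring
      _ ≤ 1 := (div_le_one hzk).2 hk2.le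
  · rw [div_le_iff₀ (by positivity)]
    have := (Nat.lt_floor_add_one (1 / z ^ k)).le
    rw [div_le_iff₀ hzk] at this
    linarith

theorem Icc_subset_closure_of_strictAntiOn {a b : ℝ} (hab : a < b) {s : Set ℝ} {u : ℝ → ℝ}
    (hcont : ContinuousOn u (Set.Ioo a b)) (hanti : StrictAntiOn u (Set.Ioo a b))
    (hmaps : Set.MapsTo u (Set.Ioo a b) (Set.Ioo 0 1))
    (hs : ∀ q ∈ Set.Ioo a b, ∀ k m : ℕ, Odd k → u q ^ k = 1 / ((m : ℝ) + 1) → q ∈ s) :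
    Set.Icc a b ⊆ closure (s ∩ Set.Icc a b) := by
  rw [← closure_Ioo hab.ne]
  refine closure_minimal (fun x hx => ?_) isClosed_closure
  rw [Metric.mem_closure_iff]
  intro δ hδ
  obtain ⟨y, hxy, hy⟩ := exists_between (lt_min hx.2 (lt_add_of_pos_right x hδ))
  have hyb : y < b := hy.trans_le (min_le_left _ _)
  have hyδ : y < x + δ := hy.trans_le (min_le_right _ _)
  have hsub : Set.Icc x y ⊆ Set.Ioo a b := fun t ht => ⟨hx.1.trans_le ht.1, ht.2.trans_lt hyb⟩
  have hx' := hsub (Set.left_mem_Icc.2 hxy.le)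
  have hy' := hsub (Set.right_mem_Icc.2 hxy.le)
  obtain ⟨k, m, hk, hkm⟩ := exists_nat_mem_Icc_pow_inv (hmaps hy').1 (hanti hx' hy' hxy)
    (hmaps hx').2
  obtain ⟨q, hq, hqm⟩ := intermediate_value_Icc' hxy.le ((hcont.mono hsub).pow k) hkm
  refine ⟨q, ⟨hs q (hsub hq) k m hk hqm, subset_closure (hsub hq)⟩, ?_⟩
  rw [Real.dist_eq, abs_sub_lt_iff]
  constructor <;> linarith [hq.1, hq.2]

theorem pow_add_mul_pow_eq_zero {T S : ℝ} (hT : T ≠ 0) {k m : ℕ} (hk : Odd k)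
    (h : (-S / T) ^ k = 1 / ((m : ℝ) + 1)) : T ^ k + (m + 1) * S ^ k = 0 := by
  have hTk : T ^ k ≠ 0 := pow_ne_zero k hT
  have hm : (m : ℝ) + 1 ≠ 0 := by positivity
  rw [div_pow, hk.neg_pow, div_eq_div_iff hTk hm] at h
  linarith

theorem Icc_subset_closure_roots_of_path :
    Set.Icc (-1 / 3 : ℝ) 0 ⊆ closure (realReliabilityRoots ∩ Set.Icc (-1 / 3 : ℝ) 0) := by
  have hpos : ∀ q ∈ Set.Ioo (-1 / 3 : ℝ) 0, 0 < 1 + q := fun q hq => by linarith [hq.1]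
  refine Icc_subset_closure_of_strictAntiOn (u := fun q => -(2 * q) / (1 + q)) (by norm_num)
    ?_ ?_ ?_ ?_
  · exact ContinuousOn.div (by fun_prop) (by fun_prop) fun q hq => (hpos q hq).ne'
  · intro x hx y hy hxy
    rw [div_lt_div_iff₀ (hpos y hy) (hpos x hx)]
    linarith
  · intro q hq
    have h := hpos q hq
    exact ⟨div_pos (by linarith [hq.2]) h, (div_lt_one h).2 (by linarith [hq.1])⟩
  · intro q hq k m hk h
    have h := pow_add_mul_pow_eq_zero (hpos q hq).ne' hk h
    refine mem_realReliabilityRoots_of_path (m := m) (k := k) hk.pos.ne' ?_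
    rw [show 1 - q ^ 2 = (1 - q) * (1 + q) by ring, mul_comm (2 * q), mul_pow, mul_pow]
    linear_combination (1 - q) ^ k * h

theorem Icc_subset_closure_roots_of_diamond {β : ℝ} (hβ : -1 < β) (hβ' : β < -1 / 3)
    (hroot : 8 * β ^ 3 + 5 * β ^ 2 + 2 * β + 1 = 0) :
    Set.Icc β (-1 / 3) ⊆ closure (realReliabilityRoots ∩ Set.Icc β (-1 / 3)) := by
  have hpos : ∀ q ∈ Set.Ioo β (-1 / 3), 0 < (1 + q) * (1 + q + 2 * q ^ 2) := fun q hq => by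
    have : 0 < 1 + q := by linarith [hq.1]
    positivity
  refine Icc_subset_closure_of_strictAntiOn
    (u := fun q => -(2 * q ^ 2 * (1 + 3 * q)) / ((1 + q) * (1 + q + 2 * q ^ 2))) hβ'
    ?_ ?_ ?_ ?_
  · exact ContinuousOn.div (by fun_prop) (by fun_prop) fun q hq => (hpos q hq).ne'
  · intro x hx y hy hxy
    refine div_lt_div₀ ?_ ?_ ?_ (hpos x hx)
    · nlinarith [hx.2, hy.2, mul_pos (sub_pos.2 hxy) (sub_pos.2 hx.2),
        mul_pos (sub_pos.2 hxy) (sub_pos.2 hy.2)]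
    · nlinarith [sq_nonneg (x + y), sq_nonneg (x - y), sq_nonneg (x + y + 1)]
    · nlinarith [hx.2, sq_nonneg x]
  · intro q hq
    have h := hpos q hq
    refine ⟨div_pos ?_ h, (div_lt_one h).2 ?_⟩
    · have : 0 < q ^ 2 := by nlinarith [hq.2]
      nlinarith [hq.2]
    · have : 0 < 8 * (q ^ 2 + q * β + β ^ 2) + 5 * (q + β) + 2 := by
        nlinarith [sq_nonneg (q + β), sq_nonneg (q - β), sq_nonneg (12 * (q + β) + 10)]
      nlinarith [mul_pos (sub_pos.2 hq.1) this]
  · intro q hq k m hk h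
    have h := pow_add_mul_pow_eq_zero (hpos q hq).ne' hk h
    refine mem_realReliabilityRoots_of_diamond (m := m) (k := k) hk.pos.ne' ?_
    rw [mul_pow, mul_pow ((1 - q) ^ 2)]
    linear_combination ((1 - q) ^ 2) ^ k * h

theorem reliabilityBeta_isRoot :
    8 * reliabilityBeta ^ 3 + 5 * reliabilityBeta ^ 2 + 2 * reliabilityBeta + 1 = 0 := by
  have hs : Real.sqrt 708 ^ 2 = 708 := Real.sq_sqrt (by norm_num)
  have hs0 : (266 / 10 : ℝ) < Real.sqrt 708 := Real.lt_sqrt_of_sq_lt (by norm_num)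
  set K := 3 * Real.sqrt 708 - 629 / 8 with hK
  have hK0 : 0 < K := by linarith
  have hKq : K ^ 2 + 629 / 4 * K - 12167 / 64 = 0 := by rw [hK]; linear_combination 9 * hs
  have hc0 : 0 < K ^ (1 / 3 : ℝ) := Real.rpow_pos_of_pos hK0 _
  have hc3 : (K ^ (1 / 3 : ℝ)) ^ 3 = K := by
    rw [← Real.rpow_natCast, ← Real.rpow_mul hK0.le]
    norm_num
  unfold reliabilityBeta
  rw [← hK]
  set c := K ^ (1 / 3 : ℝ) with hc
  have hc6 : c ^ 6 + 629 / 4 * c ^ 3 - 12167 / 64 = 0 := by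
    rw [← hKq, ← hc3]; ring
  field_simp
  linear_combination 12230590464 * hc6

theorem abs_reliabilityBeta_sub_le : |reliabilityBeta - (-0.5707202981)| ≤ 1e-10 := by
  have hroot := reliabilityBeta_isRoot
  have hmono : ∀ x y : ℝ, 0 < 8 * (x ^ 2 + x * y + y ^ 2) + 5 * (x + y) + 2 := fun x y => by
    nlinarith [sq_nonneg (x + y), sq_nonneg (x - y), sq_nonneg (12 * (x + y) + 10)]
  rw [abs_sub_le_iff]
  constructor
  · by_contra! h
    have := mul_pos (show 0 < reliabilityBeta - (-0.5707202981 + 1e-10) by linarith)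
      (hmono reliabilityBeta (-0.5707202981 + 1e-10))
    norm_num at this
    nlinarith
  · by_contra! h
    have := mul_pos (show 0 < (-0.5707202981 - 1e-10) - reliabilityBeta by linarith)
      (hmono reliabilityBeta (-0.5707202981 - 1e-10))
    norm_num at this
    nlinarith

/-- The real roots of the reliability polynomials of connected simple graphs that lie in
`[β, 0]` are dense in `[β, 0]`, where `β ≈ -0.5707202981`. -/
theorem theorem3 :
    |reliabilityBeta - (-0.5707202981)| ≤ 1e-10 ∧
      Set.Icc reliabilityBeta 0 ⊆
        closure (realReliabilityRoots ∩ Set.Icc reliabilityBeta 0) := by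
  have habs := abs_reliabilityBeta_sub_le
  refine ⟨habs, fun q hq => ?_⟩
  rw [abs_sub_le_iff] at habs
  norm_num at habs
  rcases le_total q (-1 / 3) with h | h
  · exact closure_mono (Set.inter_subset_inter_right _ (Set.Icc_subset_Icc_right (by norm_num)))
      (Icc_subset_closure_roots_of_diamond (by linarith) (by linarith) reliabilityBeta_isRoot
        ⟨hq.1, h⟩)
  · exact closure_mono (Set.inter_subset_inter_right _ (Set.Icc_subset_Icc_left (by linarith)))
      (Icc_subset_closure_roots_of_path ⟨h, hq.2⟩)
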